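/- Let $K:\mathbb{R}^4\to\mathbb{R}^3$ be the Kustaanheimo–Stiefel map $$K(y)=\bigl(y_1^2-y_2^2-y_3^2+y_4^2,\; 2(y_1y_2-y_3y_4),\; 2(y_1y_3+y_2y_4)\bigr).$$ Let $U\subset\mathbb{R}^3$ be open with $0\in U$, and let $\varphi:U\to\mathbb{C}$ be a function such that $\varphi\circ K:K^{-1}(U)\to\mathbb{C}$ is real analytic. Then there exist an open set $V\subset U$ with $0\in V$ and real analytic functions $\varphi^{(1)},\varphi^{(2)}:V\to\mathbb{C}$ such that $$\varphi(x)=\varphi^{(1)}(x)+|x|\,\varphi^{(2)}(x)\qquad\text{for all }x\in V,$$ where $|x|$ denotes the Euclidean norm. -/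

import Mathlib

/-- The Kustaanheimo–Stiefel transform `K : ℝ⁴ → ℝ³`,
`K(y) = (y₁² - y₂² - y₃² + y₄², 2(y₁y₂ - y₃y₄), 2(y₁y₃ + y₂y₄))`;
the coordinates `y₁, y₂, y₃, y₄` are `y 0, y 1, y 2, y 3`. -/
def kustaanheimoStiefel (y : EuclideanSpace ℝ (Fin 4)) : EuclideanSpace ℝ (Fin 3) :=
  !₂[y 0 ^ 2 - y 1 ^ 2 - y 2 ^ 2 + y 3 ^ 2,
     2 * (y 0 * y 1 - y 2 * y 3),
     2 * (y 0 * y 2 + y 1 * y 3)]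

/-! The fibres of K are circle orbits, so f = φ ∘ K is invariant under a circle action, and so is
each homogeneous Taylor term of f at 0. In the coordinates z, z̄, w, w̄ only weight-zero monomials
survive (`apply_diag_eq_sum_balanced`). These have even degree and are products of the quadratic
invariants (`exists_word_quadraticInvariants`), which equal (|x| ± x₁)/2 and (x₂ ± i x₃)/2 for x =
K(y). Thus φ(x) is formally a power series in x and |x|.

To separate even from odd powers of |x|, replace |x| by the 2×2 matrix with rows (0, |x|²/ε) and (ε,
0), which is polynomial in x and has left eigenvector (ε, |x|) with eigenvalue |x|. If H is the
resulting series of matrices, then (ε, |x|) H = φ(x) (ε, |x|). The first component, divided by ε, is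
the required decomposition. -/

/-- The complex coordinates `(z, z̄, w, w̄)` on `ℝ⁴`, where `z = y₁ + i y₄` and `w = y₂ + i y₃`. -/
noncomputable def complexCoord (y : EuclideanSpace ℝ (Fin 4)) : Fin 4 → ℂ :=
  ![y 0 + Complex.I * y 3, y 0 - Complex.I * y 3, y 1 + Complex.I * y 2, y 1 - Complex.I * y 2]

/-- The weights of `(z, z̄, w, w̄)` under the circle action. -/
def circleWeight : Fin 4 → ℤ := ![1, -1, -1, 1]

/-! ### Circle symmetry and fibres of the map -/

/-- The circle action `(z, w) ↦ (e^{it} z, e^{-it} w)`, whose orbits are the fibres of the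
Kustaanheimo–Stiefel map. -/
noncomputable def circleRotation (t : ℝ) :
    EuclideanSpace ℝ (Fin 4) →L[ℝ] EuclideanSpace ℝ (Fin 4) :=
  LinearMap.toContinuousLinearMap
    { toFun := fun y => !₂[Real.cos t * y 0 - Real.sin t * y 3, Real.cos t * y 1 + Real.sin t * y 2,
        -Real.sin t * y 1 + Real.cos t * y 2, Real.sin t * y 0 + Real.cos t * y 3]
      map_add' := fun x y => by
        ext i; fin_cases i <;> simp <;> ring
      map_smul' := fun c y => by
        ext i; fin_cases i <;> simp <;> ring }

theorem circleRotation_apply (t : ℝ) (y : EuclideanSpace ℝ (Fin 4)) :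
    circleRotation t y = !₂[Real.cos t * y 0 - Real.sin t * y 3,
      Real.cos t * y 1 + Real.sin t * y 2, -Real.sin t * y 1 + Real.cos t * y 2,
      Real.sin t * y 0 + Real.cos t * y 3] := rfl

theorem kustaanheimoStiefel_circleRotation (t : ℝ) (y : EuclideanSpace ℝ (Fin 4)) :
    kustaanheimoStiefel (circleRotation t y) = kustaanheimoStiefel y := by
  have h := Real.sin_sq_add_cos_sq t
  ext i
  fin_cases i <;> simp [kustaanheimoStiefel, circleRotation_apply]
  · linear_combination (y 0 ^ 2 - y 1 ^ 2 - y 2 ^ 2 + y 3 ^ 2) * h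
  · linear_combination (y 0 * y 1 - y 2 * y 3) * h
  · linear_combination (y 0 * y 2 + y 1 * y 3) * h

theorem complexCoord_circleRotation (t : ℝ) (y : EuclideanSpace ℝ (Fin 4)) (j : Fin 4) :
    complexCoord (circleRotation t y) j =
      Complex.exp (circleWeight j * (t * Complex.I)) * complexCoord y j := by
  have hI := Complex.I_sq
  have h1 : Complex.exp (t * Complex.I) = Complex.cos t + Complex.sin t * Complex.I :=
    Complex.exp_mul_I _
  have h2 : Complex.exp (-(t * Complex.I)) = Complex.cos t - Complex.sin t * Complex.I := by
    rw [← neg_mul, Complex.exp_mul_I, Complex.cos_neg, Complex.sin_neg]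
    ring
  fin_cases j <;>
    simp [complexCoord, circleRotation_apply, circleWeight, h1, h2] <;> ring_nf <;>
    rw [hI] <;> ring

theorem norm_kustaanheimoStiefel (y : EuclideanSpace ℝ (Fin 4)) :
    ‖kustaanheimoStiefel y‖ = ‖y‖ ^ 2 := by
  rw [← sq_eq_sq₀ (norm_nonneg _) (by positivity)]
  simp only [EuclideanSpace.real_norm_sq_eq, Fin.sum_univ_succ]
  simp [kustaanheimoStiefel]
  ring

theorem kustaanheimoStiefel_surjective : Function.Surjective kustaanheimoStiefel := by
  intro x
  have hr : ‖x‖ ^ 2 = x 0 ^ 2 + x 1 ^ 2 + x 2 ^ 2 := by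
    simp [EuclideanSpace.real_norm_sq_eq, Fin.sum_univ_succ, add_assoc]
  have hr0 := norm_nonneg x
  set r := ‖x‖
  have hx0 : 0 ≤ r + x 0 := by nlinarith [sq_nonneg (x 1), sq_nonneg (x 2)]
  rcases hx0.eq_or_lt with h | h
  · have h12 : x 1 ^ 2 + x 2 ^ 2 = 0 := by nlinarith
    have h1 : x 1 = 0 := by nlinarith [sq_nonneg (x 1), sq_nonneg (x 2)]
    have h2 : x 2 = 0 := by nlinarith [sq_nonneg (x 1), sq_nonneg (x 2)]
    refine ⟨!₂[0, √r, 0, 0], ?_⟩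
    ext i
    fin_cases i <;> simp [kustaanheimoStiefel, h1, h2, Real.sq_sqrt hr0]
    linarith
  -- In the slice y₄ = 0 the identity z z̄ = (|x| + x₁)/2 forces y₁² to have this value; the case z
  -- = 0 was treated above.
  · set s := √((r + x 0) / 2)
    have hs : s ^ 2 = (r + x 0) / 2 := Real.sq_sqrt (by linarith)
    have hs0 : s ≠ 0 := (Real.sqrt_pos.2 (by linarith)).ne'
    refine ⟨!₂[s, x 1 / (2 * s), x 2 / (2 * s), 0], ?_⟩
    ext i
    fin_cases i <;> simp [kustaanheimoStiefel]
    · field_simp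
      have h4 : s ^ 4 = ((r + x 0) / 2) ^ 2 := by rw [← hs]; ring
      ring_nf
      ring_nf at h4
      rw [h4, hs]
      linear_combination hr
    · field_simp
    · field_simp

/-! ### Invariant monomials -/

/-- The quadratic invariants `z z̄`, `w w̄`, `z w`, `z̄ w̄` of the circle action, as functions of
the complex coordinates. -/
def quadraticInvariants (ζ : Fin 4 → ℂ) : Fin 4 → ℂ :=
  ![ζ 0 * ζ 1, ζ 2 * ζ 3, ζ 0 * ζ 2, ζ 1 * ζ 3]

theorem quadraticInvariants_complexCoord (y : EuclideanSpace ℝ (Fin 4)) :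
    quadraticInvariants (complexCoord y) =
      ![(((‖kustaanheimoStiefel y‖ + kustaanheimoStiefel y 0) / 2 : ℝ) : ℂ),
        (((‖kustaanheimoStiefel y‖ - kustaanheimoStiefel y 0) / 2 : ℝ) : ℂ),
        (kustaanheimoStiefel y 1 + Complex.I * kustaanheimoStiefel y 2) / 2,
        (kustaanheimoStiefel y 1 - Complex.I * kustaanheimoStiefel y 2) / 2] := by
  have hI := Complex.I_sq
  rw [norm_kustaanheimoStiefel, EuclideanSpace.real_norm_sq_eq]
  ext j
  fin_cases j <;>
    simp [quadraticInvariants, complexCoord, kustaanheimoStiefel, Fin.sum_univ_succ]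
  · linear_combination (-(y 3 : ℂ) ^ 2) * hI
  · linear_combination (-(y 2 : ℂ) ^ 2) * hI
  · linear_combination ((y 3 : ℂ) * y 2) * hI
  · linear_combination ((y 3 : ℂ) * y 2) * hI

/-- The hypotheses say that letters of weight 1 and of weight -1 occur k times each. Any letter of
weight 1 times any letter of weight -1 is one of the four invariants, so such pairs can be split off
one at a time. -/
theorem exists_word_of_exponents (k : ℕ) : ∀ a b c d : ℕ, a + d = k → b + c = k →
    ∃ τ : Fin k → Fin 4, ∀ ζ : Fin 4 → ℂ,
      ζ 0 ^ a * ζ 1 ^ b * ζ 2 ^ c * ζ 3 ^ d = ∏ i, quadraticInvariants ζ (τ i) := by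
  induction k with
  | zero =>
    intro a b c d h1 h2
    obtain ⟨rfl, rfl⟩ : a = 0 ∧ d = 0 := by omega
    obtain ⟨rfl, rfl⟩ : b = 0 ∧ c = 0 := by omega
    exact ⟨Fin.elim0, fun ζ => by simp⟩
  | succ k ih =>
    intro a b c d h1 h2
    have key : ∀ (j : Fin 4) (a' b' c' d' : ℕ), a' + d' = k → b' + c' = k →
        (∀ ζ : Fin 4 → ℂ, ζ 0 ^ a * ζ 1 ^ b * ζ 2 ^ c * ζ 3 ^ d =
          quadraticInvariants ζ j * (ζ 0 ^ a' * ζ 1 ^ b' * ζ 2 ^ c' * ζ 3 ^ d')) →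
        ∃ τ : Fin (k + 1) → Fin 4, ∀ ζ : Fin 4 → ℂ,
          ζ 0 ^ a * ζ 1 ^ b * ζ 2 ^ c * ζ 3 ^ d = ∏ i, quadraticInvariants ζ (τ i) := by
      intro j a' b' c' d' h1' h2' h
      obtain ⟨τ, hτ⟩ := ih a' b' c' d' h1' h2'
      exact ⟨Fin.cons j τ, fun ζ => by rw [h, hτ, Fin.prod_univ_succ]; simp⟩
    rcases a with _ | a
    · obtain ⟨d, rfl⟩ : ∃ e, d = e + 1 := ⟨d - 1, by omega⟩
      rcases b with _ | b
      · obtain ⟨c, rfl⟩ : ∃ e, c = e + 1 := ⟨c - 1, by omega⟩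
        exact key 1 0 0 c d (by omega) (by omega) fun ζ => by simp [quadraticInvariants]; ring
      · exact key 3 0 b c d (by omega) (by omega) fun ζ => by simp [quadraticInvariants]; ring
    · rcases b with _ | b
      · obtain ⟨c, rfl⟩ : ∃ e, c = e + 1 := ⟨c - 1, by omega⟩
        exact key 2 a 0 c d (by omega) (by omega) fun ζ => by simp [quadraticInvariants]; ring
      · exact key 0 a b c d (by omega) (by omega) fun ζ => by simp [quadraticInvariants]; ring

/-- The general monoid allows additive uses as well: `Multiplicative` values turn this into counts
of total weight and of length. -/
theorem prod_word_eq_prod_pow {n : ℕ} {M : Type*} [CommMonoid M] (σ : Fin n → Fin 4)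
    (ζ : Fin 4 → M) :
    ∏ i, ζ (σ i) = ζ 0 ^ (Finset.univ.filter (σ · = 0)).card *
      ζ 1 ^ (Finset.univ.filter (σ · = 1)).card * ζ 2 ^ (Finset.univ.filter (σ · = 2)).card *
      ζ 3 ^ (Finset.univ.filter (σ · = 3)).card := by
  rw [← Finset.prod_fiberwise_of_maps_to (t := Finset.univ) (g := σ) (by simp)]
  have h : ∀ j, ∏ i with σ i = j, ζ (σ i) = ζ j ^ (Finset.univ.filter (σ · = j)).card := by
    intro j
    rw [Finset.prod_congr rfl (g := fun _ => ζ j), Finset.prod_const]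
    intro i hi
    rw [(Finset.mem_filter.1 hi).2]
  simp only [h, Fin.prod_univ_four]

theorem sum_circleWeight_eq {n : ℕ} (σ : Fin n → Fin 4) :
    ∑ i, circleWeight (σ i) = ((Finset.univ.filter (σ · = 0)).card : ℤ) -
      (Finset.univ.filter (σ · = 1)).card - (Finset.univ.filter (σ · = 2)).card +
      (Finset.univ.filter (σ · = 3)).card := by
  have h := prod_word_eq_prod_pow σ (fun j => Multiplicative.ofAdd (circleWeight j))
  have h' := congrArg Multiplicative.toAdd h
  simp [toAdd_prod, circleWeight] at h' ⊢
  linarith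

theorem card_eq_sum_letters {n : ℕ} (σ : Fin n → Fin 4) :
    n = (Finset.univ.filter (σ · = 0)).card + (Finset.univ.filter (σ · = 1)).card +
      (Finset.univ.filter (σ · = 2)).card + (Finset.univ.filter (σ · = 3)).card := by
  have h := prod_word_eq_prod_pow σ (fun _ => Multiplicative.ofAdd 1)
  have h' := congrArg Multiplicative.toAdd h
  simpa [toAdd_prod] using h'

theorem even_of_sum_circleWeight_eq_zero {n : ℕ} (σ : Fin n → Fin 4)
    (h : ∑ i, circleWeight (σ i) = 0) : Even n := by
  have h1 := sum_circleWeight_eq σ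
  have h2 := card_eq_sum_letters σ
  rw [Nat.even_iff]
  omega

theorem exists_word_quadraticInvariants {k : ℕ} (σ : Fin (2 * k) → Fin 4)
    (h : ∑ i, circleWeight (σ i) = 0) :
    ∃ τ : Fin k → Fin 4, ∀ ζ : Fin 4 → ℂ,
      ∏ i, ζ (σ i) = ∏ i, quadraticInvariants ζ (τ i) := by
  have h1 := sum_circleWeight_eq σ
  have h2 := card_eq_sum_letters σ
  obtain ⟨τ, hτ⟩ := exists_word_of_exponents k
    (Finset.univ.filter (σ · = 0)).card (Finset.univ.filter (σ · = 1)).card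
    (Finset.univ.filter (σ · = 2)).card (Finset.univ.filter (σ · = 3)).card (by omega) (by omega)
  exact ⟨τ, fun ζ => by rw [prod_word_eq_prod_pow, hτ]⟩

/-! ### Taylor terms in complex coordinates -/

/-- The coefficients of the real coordinates on `ℝ⁴` in terms of `complexCoord`. -/
noncomputable def complexCoordInv : Matrix (Fin 4) (Fin 4) ℂ :=
  !![1 / 2, 1 / 2, 0, 0;
     0, 0, 1 / 2, 1 / 2;
     0, 0, -Complex.I / 2, Complex.I / 2;
     -Complex.I / 2, Complex.I / 2, 0, 0]

theorem coe_eq_sum_complexCoord (y : EuclideanSpace ℝ (Fin 4)) (i : Fin 4) :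
    (y i : ℂ) = ∑ j, complexCoordInv i j * complexCoord y j := by
  have hI := Complex.I_sq
  fin_cases i <;> simp [complexCoordInv, complexCoord, Fin.sum_univ_succ] <;> ring_nf <;>
    rw [hI] <;> ring

theorem norm_complexCoordInv_le (i j : Fin 4) : ‖complexCoordInv i j‖ ≤ 1 := by
  fin_cases i <;> fin_cases j <;> norm_num [complexCoordInv]

/-- The coefficient of the monomial `∏ i, ζ (σ i)` in the expansion of the homogeneous polynomial
`y ↦ q (y, …, y)` in the complex coordinates `ζ` of `y`. -/
noncomputable def wordCoeff {n : ℕ}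
    (q : ContinuousMultilinearMap ℝ (fun _ : Fin n => EuclideanSpace ℝ (Fin 4)) ℂ)
    (σ : Fin n → Fin 4) : ℂ :=
  ∑ ρ : Fin n → Fin 4, (∏ i, complexCoordInv (ρ i) (σ i)) *
    q fun i => EuclideanSpace.single (ρ i) 1

theorem norm_wordCoeff_le {n : ℕ}
    (q : ContinuousMultilinearMap ℝ (fun _ : Fin n => EuclideanSpace ℝ (Fin 4)) ℂ)
    (σ : Fin n → Fin 4) : ‖wordCoeff q σ‖ ≤ 4 ^ n * ‖q‖ := by
  have h : ∀ ρ : Fin n → Fin 4, ‖(∏ i, complexCoordInv (ρ i) (σ i)) *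
      q fun i => EuclideanSpace.single (ρ i) 1‖ ≤ ‖q‖ := by
    intro ρ
    rw [norm_mul, norm_prod]
    have h1 : ∏ i, ‖complexCoordInv (ρ i) (σ i)‖ ≤ 1 :=
      Finset.prod_le_one (fun _ _ => norm_nonneg _) fun _ _ => norm_complexCoordInv_le _ _
    have h2 : ‖q fun i => EuclideanSpace.single (ρ i) (1 : ℝ)‖ ≤ ‖q‖ := by
      simpa using q.le_opNorm fun i => EuclideanSpace.single (ρ i) (1 : ℝ)
    simpa using mul_le_mul h1 h2 (norm_nonneg _) zero_le_one
  calc ‖wordCoeff q σ‖ ≤ ∑ _ρ : Fin n → Fin 4, ‖q‖ :=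
        norm_sum_le_of_le _ fun ρ _ => h ρ
    _ = 4 ^ n * ‖q‖ := by simp

theorem apply_diag_eq_sum_wordCoeff {n : ℕ}
    (q : ContinuousMultilinearMap ℝ (fun _ : Fin n => EuclideanSpace ℝ (Fin 4)) ℂ)
    (y : EuclideanSpace ℝ (Fin 4)) :
    (q fun _ => y) = ∑ σ : Fin n → Fin 4, wordCoeff q σ * ∏ i, complexCoord y (σ i) := by
  have hy : y = ∑ j, y j • EuclideanSpace.single j (1 : ℝ) := by
    ext i
    simp [Finset.sum_apply, Pi.single_apply]
  calc (q fun _ => y) = q fun _ => ∑ j, y j • EuclideanSpace.single j (1 : ℝ) := by rw [← hy]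
    _ = ∑ ρ : Fin n → Fin 4, (∏ i, (y (ρ i) : ℂ)) * q fun i => EuclideanSpace.single (ρ i) 1 := by
      rw [q.map_sum]
      refine Finset.sum_congr rfl fun ρ _ => ?_
      rw [q.map_smul_univ, Complex.real_smul, Complex.ofReal_prod]
    _ = ∑ ρ : Fin n → Fin 4, ∑ σ : Fin n → Fin 4, (∏ i, complexCoordInv (ρ i) (σ i)) *
          (∏ i, complexCoord y (σ i)) * q fun i => EuclideanSpace.single (ρ i) 1 := by
      refine Finset.sum_congr rfl fun ρ _ => ?_
      simp only [coe_eq_sum_complexCoord, Finset.prod_univ_sum, Finset.sum_mul,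
        Fintype.piFinset_univ, Finset.prod_mul_distrib]
    _ = _ := by
      rw [Finset.sum_comm]
      refine Finset.sum_congr rfl fun σ _ => ?_
      rw [wordCoeff, Finset.sum_mul]
      exact Finset.sum_congr rfl fun ρ _ => by ring

theorem integral_exp_int_mul_I (n : ℤ) :
    ∫ t in (0 : ℝ)..2 * Real.pi, Complex.exp (n * (t * Complex.I)) =
      if n = 0 then ((2 * Real.pi : ℝ) : ℂ) else 0 := by
  split_ifs with h
  · simp [h]
  · have hc : (n : ℂ) * Complex.I ≠ 0 := by simp [h]
    have := integral_exp_mul_complex (a := 0) (b := 2 * Real.pi) hc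
    rw [show (fun t : ℝ => Complex.exp (n * (t * Complex.I))) =
      fun t : ℝ => Complex.exp (n * Complex.I * t) from funext fun t => by ring_nf, this]
    have h2 : (n : ℂ) * Complex.I * ((2 * Real.pi : ℝ) : ℂ) = n * (2 * Real.pi * Complex.I) := by
      push_cast; ring
    rw [h2, Complex.exp_int_mul_two_pi_mul_I]
    simp

/-- Averaging over the circle multiplies each monomial by the mean of a character, which vanishes
unless the weight is zero. -/
theorem apply_diag_eq_sum_balanced {n : ℕ}
    (q : ContinuousMultilinearMap ℝ (fun _ : Fin n => EuclideanSpace ℝ (Fin 4)) ℂ)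
    (y : EuclideanSpace ℝ (Fin 4))
    (hq : ∀ t, (q fun _ => circleRotation t y) = q fun _ => y) :
    (q fun _ => y) = ∑ σ : Fin n → Fin 4 with ∑ i, circleWeight (σ i) = 0,
      wordCoeff q σ * ∏ i, complexCoord y (σ i) := by
  have hpi : ((2 * Real.pi : ℝ) : ℂ) ≠ 0 := by simp [Real.pi_ne_zero]
  have h1 : ∀ t : ℝ, (q fun _ => y) = ∑ σ : Fin n → Fin 4,
      Complex.exp ((∑ i, circleWeight (σ i) : ℤ) * (t * Complex.I)) *
        (wordCoeff q σ * ∏ i, complexCoord y (σ i)) := by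
    intro t
    rw [← hq t, apply_diag_eq_sum_wordCoeff]
    refine Finset.sum_congr rfl fun σ _ => ?_
    simp only [complexCoord_circleRotation, Finset.prod_mul_distrib, ← Complex.exp_sum]
    push_cast
    rw [Finset.sum_mul]
    ring
  have h2 : ∫ _t in (0 : ℝ)..2 * Real.pi, (q fun _ => y) =
      ∑ σ : Fin n → Fin 4, (if ∑ i, circleWeight (σ i) = 0 then ((2 * Real.pi : ℝ) : ℂ) else 0) *
        (wordCoeff q σ * ∏ i, complexCoord y (σ i)) := by
    rw [intervalIntegral.integral_congr (g := fun t : ℝ => _) fun t _ => h1 t,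
      intervalIntegral.integral_finsetSum]
    · refine Finset.sum_congr rfl fun σ _ => ?_
      rw [intervalIntegral.integral_mul_const, integral_exp_int_mul_I]
    · intro σ _
      exact Continuous.intervalIntegrable (by fun_prop) _ _
  rw [intervalIntegral.integral_const, sub_zero, Complex.real_smul] at h2
  apply mul_left_cancel₀ hpi
  rw [h2, Finset.sum_filter, Finset.mul_sum]
  refine Finset.sum_congr rfl fun σ _ => ?_
  split_ifs <;> simp

/-- Both p ∘ u and p expand f at 0, so their difference expands 0. Only the diagonal values are
determined, since p need not be symmetric. -/
theorem apply_diag_eq_of_comp_eq {E F : Type*} [NormedAddCommGroup E] [NormedSpace ℝ E]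
    [NormedAddCommGroup F] [NormedSpace ℝ F] {f : E → F} {p : FormalMultilinearSeries ℝ E F}
    (hf : HasFPowerSeriesAt f p 0) (u : E →L[ℝ] E) (hu : f ∘ u = f) (n : ℕ) (y : E) :
    (p n fun _ => u y) = p n fun _ => y := by
  have h1 : HasFPowerSeriesAt f (p.compContinuousLinearMap u) 0 := by
    have h := HasFPowerSeriesAt.compContinuousLinearMap (u := u) (x := 0) (f := f) (pf := p)
      (by rwa [map_zero])
    rwa [hu] at h
  have h2 := h1.sub hf
  rw [sub_self] at h2
  have h3 := h2.apply_eq_zero n y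
  exact sub_eq_zero.1 h3

-- Power series in the invariants over a normed algebra

attribute [local instance] Matrix.linftyOpNormedRing Matrix.linftyOpNormedAlgebra

open Classical in
/-- A word in the quadratic invariants representing the same monomial as the balanced word `σ`. -/
noncomputable def reducedWord {k : ℕ} (σ : Fin (2 * k) → Fin 4) : Fin k → Fin 4 :=
  if h : ∑ i, circleWeight (σ i) = 0 then (exists_word_quadraticInvariants σ h).choose
  else fun _ => 0

theorem prod_reducedWord {k : ℕ} (σ : Fin (2 * k) → Fin 4) (h : ∑ i, circleWeight (σ i) = 0)
    (ζ : Fin 4 → ℂ) :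
    ∏ i, ζ (σ i) = ∏ i, quadraticInvariants ζ (reducedWord σ i) := by
  rw [reducedWord, dif_pos h]
  exact (exists_word_quadraticInvariants σ h).choose_spec ζ

/-- The power series in four (noncommuting) variables obtained from an invariant power series `p`
by writing its balanced monomials in terms of the quadratic invariants. -/
noncomputable def invariantSeries (A : Type*) [NormedRing A] [NormedAlgebra ℂ A]
    (p : FormalMultilinearSeries ℝ (EuclideanSpace ℝ (Fin 4)) ℂ) :
    FormalMultilinearSeries ℂ (Fin 4 → A) A := fun k =>
  ∑ σ : Fin (2 * k) → Fin 4 with ∑ i, circleWeight (σ i) = 0,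
    wordCoeff (p (2 * k)) σ • (ContinuousMultilinearMap.mkPiAlgebraFin ℂ k A).compContinuousLinearMap
      fun i => ContinuousLinearMap.proj (reducedWord σ i)

theorem invariantSeries_apply (A : Type*) [NormedRing A] [NormedAlgebra ℂ A]
    (p : FormalMultilinearSeries ℝ (EuclideanSpace ℝ (Fin 4)) ℂ) (k : ℕ)
    (m : Fin k → Fin 4 → A) : invariantSeries A p k m =
      ∑ σ : Fin (2 * k) → Fin 4 with ∑ i, circleWeight (σ i) = 0,
        wordCoeff (p (2 * k)) σ • (List.ofFn fun i => m i (reducedWord σ i)).prod := by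
  simp [invariantSeries]

theorem norm_invariantSeries_le (A : Type*) [NormedRing A] [NormOneClass A] [NormedAlgebra ℂ A]
    (p : FormalMultilinearSeries ℝ (EuclideanSpace ℝ (Fin 4)) ℂ) (k : ℕ) :
    ‖invariantSeries A p k‖ ≤ 4 ^ (2 * k) * (4 ^ (2 * k) * ‖p (2 * k)‖) := by
  refine ContinuousMultilinearMap.opNorm_le_bound (by positivity) fun m => ?_
  have h : ∀ σ : Fin (2 * k) → Fin 4,
      ‖wordCoeff (p (2 * k)) σ • (List.ofFn fun i => m i (reducedWord σ i)).prod‖ ≤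
        4 ^ (2 * k) * ‖p (2 * k)‖ * ∏ i, ‖m i‖ := by
    intro σ
    have h1 : ‖(List.ofFn fun i => m i (reducedWord σ i)).prod‖ ≤ ∏ i, ‖m i‖ := by
      have h2 := (ContinuousMultilinearMap.mkPiAlgebraFin ℂ k A).le_opNorm
        fun i => m i (reducedWord σ i)
      rw [ContinuousMultilinearMap.norm_mkPiAlgebraFin, one_mul,
        ContinuousMultilinearMap.mkPiAlgebraFin_apply] at h2
      exact h2.trans (Finset.prod_le_prod (fun _ _ => norm_nonneg _)
        fun i _ => norm_le_pi_norm (m i) _)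
    rw [norm_smul]
    exact mul_le_mul (norm_wordCoeff_le _ _) h1 (norm_nonneg _) (by positivity)
  rw [invariantSeries_apply]
  calc _ ≤ ∑ σ : Fin (2 * k) → Fin 4 with ∑ i, circleWeight (σ i) = 0,
          4 ^ (2 * k) * ‖p (2 * k)‖ * ∏ i, ‖m i‖ := norm_sum_le_of_le _ fun σ _ => h σ
    _ ≤ ∑ _σ : Fin (2 * k) → Fin 4, 4 ^ (2 * k) * ‖p (2 * k)‖ * ∏ i, ‖m i‖ :=
        Finset.sum_le_sum_of_subset_of_nonneg (Finset.filter_subset _ _)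
          fun _ _ _ => by positivity
    _ = _ := by simp [mul_assoc]

theorem invariantSeries_radius_pos (A : Type*) [NormedRing A] [NormOneClass A] [NormedAlgebra ℂ A]
    {p : FormalMultilinearSeries ℝ (EuclideanSpace ℝ (Fin 4)) ℂ} (hp : 0 < p.radius) :
    0 < (invariantSeries A p).radius := by
  obtain ⟨C, a, hC, ha, h⟩ := p.le_mul_pow_of_radius_pos hp
  -- 256 = 4² · 4²: one factor counts the words of length 2k, the other bounds their coefficients.
  have hb : 0 < (256 * a ^ 2)⁻¹ := by positivity
  refine lt_of_lt_of_le ?_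
    ((invariantSeries A p).le_radius_of_bound C (r := ⟨(256 * a ^ 2)⁻¹, hb.le⟩) fun k => ?_)
  · exact ENNReal.coe_pos.2 hb
  · have h1 := norm_invariantSeries_le A p k
    calc ‖invariantSeries A p k‖ * ((256 * a ^ 2)⁻¹) ^ k
        ≤ (4 ^ (2 * k) * (4 ^ (2 * k) * (C * a ^ (2 * k)))) * ((256 * a ^ 2)⁻¹) ^ k := by
          gcongr
          exact h1.trans (by gcongr; exact h _)
      _ = C * ((4 ^ 2 * (4 ^ 2 * a ^ 2)) * (256 * a ^ 2)⁻¹) ^ k := by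
          simp only [pow_mul, mul_pow]
          ring
      _ = C := by
          rw [show (4 ^ 2 * (4 ^ 2 * a ^ 2)) * (256 * a ^ 2)⁻¹ = 1 by field_simp; norm_num]
          simp

/-! ### Separating powers of the norm by a common eigenvector -/

theorem vecMul_prod_ofFn {ι R : Type*} [Fintype ι] [DecidableEq ι] [CommRing R] {n : ℕ}
    (v : ι → R) (N : Fin n → Matrix ι ι R) (c : Fin n → R)
    (h : ∀ i, Matrix.vecMul v (N i) = c i • v) :
    Matrix.vecMul v (List.ofFn N).prod = (∏ i, c i) • v := by
  induction n with
  | zero => simp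
  | succ n ih =>
    rw [List.ofFn_succ, List.prod_cons, ← Matrix.vecMul_vecMul, h, Matrix.smul_vecMul,
      ih (fun i => N i.succ) (fun i => c i.succ) fun i => h i.succ, Fin.prod_univ_succ, smul_smul]

/-- On a common left eigenvector the matrices act as scalars, so the order of the letters in a
reduced word does not matter. -/
theorem vecMul_invariantSeries {p : FormalMultilinearSeries ℝ (EuclideanSpace ℝ (Fin 4)) ℂ}
    {ι : Type*} [Fintype ι] [DecidableEq ι] [Nonempty ι]
    {y : EuclideanSpace ℝ (Fin 4)} {k : ℕ}
    (hp : ∀ t, (p (2 * k) fun _ => circleRotation t y) = p (2 * k) fun _ => y)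
    (v : ι → ℂ) (M : Fin 4 → Matrix ι ι ℂ)
    (h : ∀ j, Matrix.vecMul v (M j) = quadraticInvariants (complexCoord y) j • v) :
    Matrix.vecMul v (invariantSeries (Matrix ι ι ℂ) p k fun _ => M) =
      (p (2 * k) fun _ => y) • v := by
  rw [invariantSeries_apply, apply_diag_eq_sum_balanced _ _ hp, Matrix.vecMul_sum, Finset.sum_smul]
  refine Finset.sum_congr rfl fun σ hσ => ?_
  rw [Matrix.vecMul_smul, vecMul_prod_ofFn v _ _ fun i => h (reducedWord σ i),
    prod_reducedWord σ (Finset.mem_filter.1 hσ).2, smul_smul]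

/-- Matrices depending analytically on `x` which act on the row vector `(ε, ‖x‖)` as the scalars
`quadraticInvariants (complexCoord y)`, for every `y` in the fibre over `x`. -/
noncomputable def invariantMatrices (ε : ℂ) (x : EuclideanSpace ℝ (Fin 3)) :
    Fin 4 → Matrix (Fin 2) (Fin 2) ℂ :=
  ![!![x 0 / 2, (x 0 ^ 2 + x 1 ^ 2 + x 2 ^ 2) / (2 * ε); ε / 2, x 0 / 2],
    !![-x 0 / 2, (x 0 ^ 2 + x 1 ^ 2 + x 2 ^ 2) / (2 * ε); ε / 2, -x 0 / 2],
    !![(x 1 + Complex.I * x 2) / 2, 0; 0, (x 1 + Complex.I * x 2) / 2],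
    !![(x 1 - Complex.I * x 2) / 2, 0; 0, (x 1 - Complex.I * x 2) / 2]]

theorem vecMul_invariantMatrices {ε : ℂ} (hε : ε ≠ 0) (y : EuclideanSpace ℝ (Fin 4)) (j : Fin 4) :
    Matrix.vecMul ![ε, (‖kustaanheimoStiefel y‖ : ℂ)]
      (invariantMatrices ε (kustaanheimoStiefel y) j) =
      quadraticInvariants (complexCoord y) j • ![ε, (‖kustaanheimoStiefel y‖ : ℂ)] := by
  rw [quadraticInvariants_complexCoord]
  generalize kustaanheimoStiefel y = x
  have hr : ((‖x‖ : ℝ) : ℂ) ^ 2 = x 0 ^ 2 + x 1 ^ 2 + x 2 ^ 2 := by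
    rw [← Complex.ofReal_pow, EuclideanSpace.real_norm_sq_eq]
    simp [Fin.sum_univ_succ, add_assoc]
  ext i
  fin_cases j <;> fin_cases i <;> simp [invariantMatrices, Matrix.vecMul, dotProduct, ← hr] <;>
    field_simp <;> ring

theorem AnalyticAt.matrix {E m : Type*} [NormedAddCommGroup E] [NormedSpace ℝ E]
    [Fintype m] [DecidableEq m] {f : E → Matrix m m ℂ} {x : E}
    (h : ∀ i j, AnalyticAt ℝ (fun x => f x i j) x) : AnalyticAt ℝ f x := by
  have h1 : AnalyticAt ℝ (fun x => (fun i j => f x i j : m → m → ℂ)) x :=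
    AnalyticAt.pi fun i => AnalyticAt.pi fun j => h i j
  let L : (m → m → ℂ) →L[ℝ] Matrix m m ℂ :=
    LinearMap.toContinuousLinearMap (Matrix.ofLinearEquiv ℝ).toLinearMap
  exact (L.analyticAt _).comp h1

theorem analyticAt_invariantMatrices (ε : ℂ) (x : EuclideanSpace ℝ (Fin 3)) :
    AnalyticAt ℝ (invariantMatrices ε) x := by
  have hc : ∀ i : Fin 3, AnalyticAt ℝ (fun x : EuclideanSpace ℝ (Fin 3) => (x i : ℂ)) x := fun i =>
    (Complex.ofRealCLM.comp (EuclideanSpace.proj i : _ →L[ℝ] ℝ)).analyticAt x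
  have h0 := hc 0
  have h1 := hc 1
  have h2 := hc 2
  refine AnalyticAt.pi fun j => AnalyticAt.matrix fun i k => ?_
  fin_cases j <;> fin_cases i <;> fin_cases k <;> simp [invariantMatrices, div_eq_mul_inv] <;>
    fun_prop

/-- At x = 0 the entries with ε in the denominator vanish and the rest is linear in ε, so a small
nonzero ε brings the matrices into any neighbourhood of 0. -/
theorem exists_invariantMatrices_zero_mem {s : Set (Fin 4 → Matrix (Fin 2) (Fin 2) ℂ)}
    (hs : s ∈ nhds 0) : ∃ ε : ℂ, ε ≠ 0 ∧ invariantMatrices ε 0 ∈ s := by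
  have h : ∀ ε : ℂ, invariantMatrices ε 0 = ε • invariantMatrices 1 0 := by
    intro ε
    ext j i k
    fin_cases j <;> fin_cases i <;> fin_cases k <;> simp [invariantMatrices, div_eq_mul_inv]
  have hc : Filter.Tendsto (fun ε : ℂ => ε • invariantMatrices 1 0) (nhds 0) (nhds 0) := by
    have : Continuous fun ε : ℂ => ε • invariantMatrices 1 0 := by fun_prop
    simpa using this.tendsto 0
  obtain ⟨ε, h1, h2⟩ := (((hc.eventually hs).filter_mono nhdsWithin_le_nhds).and
    (self_mem_nhdsWithin (s := {0}ᶜ))).exists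
  exact ⟨ε, h2, by rw [h]; exact h1⟩

/-! ### The decomposition near the origin -/

theorem proposition4p1 (U : Set (EuclideanSpace ℝ (Fin 3))) (hU : IsOpen U)
    (h0 : (0 : EuclideanSpace ℝ (Fin 3)) ∈ U)
    (φ : EuclideanSpace ℝ (Fin 3) → ℂ)
    (hφ : AnalyticOnNhd ℝ (fun y : EuclideanSpace ℝ (Fin 4) => φ (kustaanheimoStiefel y))
      (kustaanheimoStiefel ⁻¹' U)) :
    ∃ (V : Set (EuclideanSpace ℝ (Fin 3))) (φ₁ φ₂ : EuclideanSpace ℝ (Fin 3) → ℂ),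
      IsOpen V ∧ (0 : EuclideanSpace ℝ (Fin 3)) ∈ V ∧ V ⊆ U ∧
      AnalyticOnNhd ℝ φ₁ V ∧ AnalyticOnNhd ℝ φ₂ V ∧
      ∀ x ∈ V, φ x = φ₁ x + ((‖x‖ : ℝ) : ℂ) * φ₂ x := by
  have hK0 : kustaanheimoStiefel 0 = 0 := by
    rw [← norm_eq_zero, norm_kustaanheimoStiefel]
    simp
  obtain ⟨p, R, hf⟩ := hφ 0 (by simpa [hK0] using h0)
  have hinv : ∀ t n y, (p n fun _ => circleRotation t y) = p n fun _ => y := fun t n y =>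
    apply_diag_eq_of_comp_eq ⟨R, hf⟩ (circleRotation t)
      (by ext y; simp [kustaanheimoStiefel_circleRotation]) n y
  obtain ⟨ρ, hρ0, hρR⟩ := ENNReal.lt_iff_exists_nnreal_btwn.1 hf.r_pos
  rw [ENNReal.coe_pos] at hρ0
  set H := invariantSeries (Matrix (Fin 2) (Fin 2) ℂ) p
  have hH := H.hasFPowerSeriesOnBall
    (invariantSeries_radius_pos (Matrix (Fin 2) (Fin 2) ℂ) hf.radius_pos)
  obtain ⟨ε, hε, hεmem⟩ := exists_invariantMatrices_zero_mem
    (Metric.eball_mem_nhds 0 hH.r_pos)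
  let M := invariantMatrices ε
  have hMan : ∀ x, AnalyticAt ℝ M x := analyticAt_invariantMatrices ε
  have hMcont : Continuous M := continuous_iff_continuousAt.2 fun x => (hMan x).continuousAt
  let entry (i j : Fin 2) : Matrix (Fin 2) (Fin 2) ℂ →L[ℂ] ℂ :=
    LinearMap.toContinuousLinearMap (Matrix.entryLinearMap ℂ ℂ i j)
  -- The radius is ρ² because ‖K(y)‖ = ‖y‖²: every preimage of a point of V then has norm below ρ <
  -- R.
  let V := U ∩ M ⁻¹' Metric.eball 0 H.radius ∩ Metric.ball 0 ((ρ : ℝ) ^ 2)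
  have han : ∀ i j, AnalyticOnNhd ℝ (fun x => entry i j (H.sum (M x))) V := by
    intro i j x hx
    have h1 : AnalyticAt ℝ H.sum (M x) := (hH.analyticOnNhd _ hx.1.2).restrictScalars
    exact (((entry i j).restrictScalars ℝ).analyticAt _).comp (h1.comp (hMan x))
  refine ⟨V, fun x => entry 0 0 (H.sum (M x)), fun x => entry 1 0 (H.sum (M x)) * ε⁻¹,
    (hU.inter (Metric.isOpen_eball.preimage hMcont)).inter Metric.isOpen_ball,
    ⟨⟨h0, hεmem⟩, Metric.mem_ball_self (by positivity)⟩, fun x hx => hx.1.1, han 0 0,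
    fun x hx => (han 1 0 x hx).mul analyticAt_const, fun x hx => ?_⟩
  obtain ⟨y, rfl⟩ := kustaanheimoStiefel_surjective x
  have hy : y ∈ Metric.eball (0 : EuclideanSpace ℝ (Fin 4)) R := by
    have h1 : ‖y‖ ^ 2 < (ρ : ℝ) ^ 2 := by
      simpa [norm_kustaanheimoStiefel] using hx.2
    have h2 : ‖y‖ < ρ := lt_of_pow_lt_pow_left₀ 2 ρ.2 h1
    rw [Metric.mem_eball, edist_zero_right]
    exact lt_trans (by rw [enorm_lt_coe]; exact_mod_cast h2) hρR
  have hsum : HasSum (fun n => p n fun _ => y) (φ (kustaanheimoStiefel y)) := by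
    simpa using hf.hasSum hy
  -- Odd-degree terms vanish because no word of odd length has weight zero.
  have heven : HasSum (fun k => p (2 * k) fun _ => y) (φ (kustaanheimoStiefel y)) := by
    have hinj : Function.Injective fun k : ℕ => 2 * k := fun a b h => by simpa using h
    refine (hinj.hasSum_iff fun n hn => ?_).2 hsum
    rw [apply_diag_eq_sum_balanced _ _ fun t => hinv t n y]
    refine Finset.sum_eq_zero fun σ hσ => absurd ?_ hn
    obtain ⟨k, hk⟩ := even_of_sum_circleWeight_eq_zero σ (Finset.mem_filter.1 hσ).2
    exact ⟨k, by simp only; omega⟩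
  have hHsum : HasSum (fun k => H k fun _ => M (kustaanheimoStiefel y))
      (H.sum (M (kustaanheimoStiefel y))) := by
    have h := hH.hasSum hx.1.2
    rw [zero_add] at h
    exact h
  have hcomb := ((hHsum.mapL (entry 0 0)).mul_left ε).add
    ((hHsum.mapL (entry 1 0)).mul_left (‖kustaanheimoStiefel y‖ : ℂ))
  have hterm : ∀ k, ε * entry 0 0 (H k fun _ => M (kustaanheimoStiefel y)) +
      (‖kustaanheimoStiefel y‖ : ℂ) * entry 1 0 (H k fun _ => M (kustaanheimoStiefel y)) =
      (p (2 * k) fun _ => y) * ε := by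
    intro k
    have h := congrFun (vecMul_invariantSeries (fun t => hinv t (2 * k) y) _ _
      (vecMul_invariantMatrices hε y)) 0
    simp [Matrix.vecMul, dotProduct, Fin.sum_univ_two] at h
    exact h
  simp only [hterm] at hcomb
  have := (heven.mul_right ε).unique hcomb
  field_simp
  linear_combination this
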